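/- Equip $\mathbb R^n$ with its Euclidean norm. A function $F:\mathbb R^n\to[-\infty,\infty]$ is proper if it never equals $-\infty$ and $\operatorname{dom}F=\{x: F(x)<\infty\}\neq\emptyset$, and closed if it is lower semicontinuous. For proper $F$ and $x\in\operatorname{dom}F$, the regular subdifferential $\widehat\partial F(x)$ is the set of all $v\in\mathbb R^n$ with $$\liminf_{z\to x,\ z\ne x}\frac{F(z)-F(x)-\langle v,z-x\rangle}{\|z-x\|}\ge 0,$$ and the (limiting) subdifferential $\partial F(x)$ is the set of all $v$ for which there are $x^t\to x$ with $F(x^t)\to F(x)$ and $v^t\in\widehat\partial F(x^t)$ with $v^t\to v$; both are empty for $x\notin\operatorname{dom}F$. Put $\operatorname{dom}\partial F=\{x:\partial F(x)\ne\emptyset\}$ and $\operatorname{dist}(0,S)=\inf_{v\in S}\|v\|$, with $\operatorname{dist}(0,\emptyset)=\infty$. For $\alpha\in[0,1)$, a proper closed function $F$ has the Kurdyka–Łojasiewicz (KL) property with exponent $\alpha$ at $\bar x\in\operatorname{dom}\partial F$ if there are $c,\epsilon>0$ and $\nu\in(0,\infty]$ such that $$\operatorname{dist}(0,\partial F(x))\ge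 c\,(F(x)-F(\bar x))^{\alpha}\quad\text{whenever } \|x-\bar x\|\le\epsilon \text{ and } F(\bar x)<F(x)<F(\bar x)+\nu,$$ and $F$ is a KL function with exponent $\alpha$ if this holds at every $\bar x\in\operatorname{dom}\partial F$. For a set $S$, let $\delta_S$ be $0$ on $S$ and $+\infty$ elsewhere. **Theorem (KL exponent from Lagrangian relaxation).** Let $l:\mathbb R^m\to\mathbb R$ be continuous and strictly convex, $A\in\mathbb R^{m\times n}$, and $h(x)=l(Ax)$ for $x\in\mathbb R^n$. Let $g:\mathbb R^n\to\mathbb R$ be continuous and convex, $\alpha\in(0,1)$, $D\subseteq\mathbb R^n$ closed and convex, and $C=\{x\in\mathbb R^n: g(x)\le 0\}$. Suppose that 1. there exists $x_0\in D$ with $g(x_0)<0$; 2. $\inf_{x\in D}h(x)<\inf_{x\in C\cap D}h(x)$ (infima in $[-\infty,\infty]$); 3. for every $\lambda>0$, the function $h+\lambda g+\delta_D$ is a KL function with exponent $\alpha$. Then every $\bar x\in C\cap D$ belongs to $\operatorname{dom}\partial(h+\delta_C+\delta_D)$, and the proper closed function $h+\delta_C+\delta_D$ has the KL property with exponent $\alpha$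 at every $\bar x\in C\cap D$. -/

import Mathlib

open Set Filter Topology

noncomputable section

variable {E : Type*} [NormedAddCommGroup E] [InnerProductSpace ℝ E]

/-- The indicator function `δ_S` of convex analysis: `0` on `S` and `+∞` off `S`. -/
def indicatorE (S : Set E) (x : E) : EReal :=
  open Classical in if x ∈ S then 0 else ⊤

/-- A function is proper if it never takes the value `-∞` and its domain
`{x | f x < ∞}` is nonempty. -/
def IsProper (f : E → EReal) : Prop :=
  (∀ x, f x ≠ ⊥) ∧ ∃ x, f x < ⊤

/-- The regular (Fréchet) subdifferential: the vectors `v` with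
`liminf_{z → x, z ≠ x} (f z - f x - ⟪v, z - x⟫) / ‖z - x‖ ≥ 0` if `x` is in the domain of `f`,
and the empty set otherwise. -/
def regularSubdifferential (f : E → EReal) (x : E) : Set E :=
  {v | f x < ⊤ ∧
    0 ≤ liminf (fun z : E => (f z - f x - ((inner ℝ v (z - x) : ℝ) : EReal)) /
      ((‖z - x‖ : ℝ) : EReal)) (𝓝[≠] x)}

/-- The limiting subdifferential: the limits of regular subgradients `vs t` at points `xs t` with
`xs t → x` and `f (xs t) → f x` if `x` is in the domain of `f`, and the empty set otherwise. -/
def limitingSubdifferential (f : E → EReal) (x : E) : Set E :=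
  {v | f x < ⊤ ∧ ∃ (xs : ℕ → E) (vs : ℕ → E),
    Tendsto xs atTop (𝓝 x) ∧ Tendsto (fun t => f (xs t)) atTop (𝓝 (f x)) ∧
    (∀ t, vs t ∈ regularSubdifferential f (xs t)) ∧ Tendsto vs atTop (𝓝 v)}

/-- The proper closed function `f` has the Kurdyka–Łojasiewicz property at the point `a` of
`dom ∂f` with exponent `α ∈ [0, 1)`: there are `c, ε > 0` and `ν ∈ (0, ∞]` such that
`dist (0, ∂f x) ≥ c (f x - f a) ^ α` whenever `‖x - a‖ ≤ ε` and `f a < f x < f a + ν`.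
Distances are extended, so that the distance to the empty set is `∞`. The values `f a` and
`f x` are finite where their difference is converted to a real number. -/
structure HasKLExponentAt (f : E → EReal) (α : ℝ) (a : E) : Prop where
  proper : IsProper f
  closed : LowerSemicontinuous f
  exponent_nonneg : 0 ≤ α
  exponent_lt_one : α < 1
  mem_dom : (limitingSubdifferential f a).Nonempty
  bound : ∃ c : ℝ, 0 < c ∧ ∃ ε : ℝ, 0 < ε ∧ ∃ ν : EReal, 0 < ν ∧
    ∀ x : E, ‖x - a‖ ≤ ε → f a < f x → f x < f a + ν →
      ENNReal.ofReal (c * (f x - f a).toReal ^ α) ≤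
        Metric.infEDist 0 (limitingSubdifferential f x)

/-- A proper closed function is a KL function with exponent `α ∈ [0, 1)` if it has the KL property
with exponent `α` at every point of `dom ∂f`. -/
structure IsKLFunctionWithExponent (f : E → EReal) (α : ℝ) : Prop where
  proper : IsProper f
  closed : LowerSemicontinuous f
  exponent_nonneg : 0 ≤ α
  exponent_lt_one : α < 1
  kl : ∀ a : E, (limitingSubdifferential f a).Nonempty → HasKLExponentAt f α a

end

/-! For a convex function restricted to a closed convex set, limiting subgradients are the
subgradients of convex analysis, so every KL bound is a bound on the latter. If `a` does not
minimize `h` over `C ∩ D`, the subgradients near `a` are bounded away from `0` and the claim is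
immediate. Otherwise Slater's condition gives a multiplier `lam` for which `a` minimizes `r = h +
lam * g` over `D`. The strict gap between the two infima forces `lam > 0`, hence `g a = 0`. Strict
convexity of `l` makes `A x` constant on the minimizers of `r` over `D`, so `h` and `g` are constant
there too, and each of them lies in `C` and minimizes `h` over `C ∩ D`. At a minimizer of a convex
function, the KL property with exponent `α` amounts to an error bound of order `1 - α`
(`ConvexOn.exists_error_bound`, `ConvexOn.hasKLExponentAt_of_error_bound`). The bound for `r` passes
to `h`, since `r ≤ h` on `C` and `r a = h a`. -/

/-! ### Real functions restricted by an indicator -/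

theorem add_indicatorE_of_mem {X : Type*} {S : Set X} (r : X → ℝ) {x : X} (hx : x ∈ S) :
    (r x : EReal) + indicatorE S x = r x := by
  simp [indicatorE, hx]

theorem add_indicatorE_of_notMem {X : Type*} {S : Set X} (r : X → ℝ) {x : X} (hx : x ∉ S) :
    (r x : EReal) + indicatorE S x = ⊤ := by
  simp [indicatorE, hx]

theorem add_indicatorE_lt_top_iff {X : Type*} {S : Set X} {r : X → ℝ} {x : X} :
    (r x : EReal) + indicatorE S x < ⊤ ↔ x ∈ S := by
  by_cases hx : x ∈ S
  · simp [add_indicatorE_of_mem r hx, hx, EReal.coe_lt_top]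
  · simp [add_indicatorE_of_notMem r hx, hx]

theorem indicatorE_add_indicatorE {X : Type*} (S T : Set X) (x : X) :
    indicatorE S x + indicatorE T x = indicatorE (S ∩ T) x := by
  by_cases hS : x ∈ S <;> by_cases hT : x ∈ T <;> simp [indicatorE, hS, hT]

theorem isProper_add_indicatorE {X : Type*} {S : Set X} (r : X → ℝ) (hS : S.Nonempty) :
    IsProper fun x => (r x : EReal) + indicatorE S x := by
  refine ⟨fun x => ?_, hS.imp fun x hx => add_indicatorE_lt_top_iff.2 hx⟩
  by_cases hx : x ∈ S
  · simp [add_indicatorE_of_mem r hx]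
  · simp [add_indicatorE_of_notMem r hx]

theorem lowerSemicontinuous_add_indicatorE {X : Type*} [TopologicalSpace X] {S : Set X}
    {r : X → ℝ} (hS : IsClosed S) (hr : Continuous r) :
    LowerSemicontinuous fun x => (r x : EReal) + indicatorE S x := by
  intro x y hy
  by_cases hx : x ∈ S
  · simp only [add_indicatorE_of_mem r hx] at hy
    have : Continuous fun x => (r x : EReal) := continuous_coe_real_ereal.comp hr
    filter_upwards [this.continuousAt.eventually (lt_mem_nhds hy)] with z hz
    by_cases hzS : z ∈ S
    · simpa only [add_indicatorE_of_mem r hzS] using hz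
    · simpa only [add_indicatorE_of_notMem r hzS] using hz.trans (EReal.coe_lt_top _)
  · simp only [add_indicatorE_of_notMem r hx] at hy
    filter_upwards [hS.isOpen_compl.mem_nhds hx] with z hz
    simpa only [add_indicatorE_of_notMem r hz] using hy

/-! ### Limiting and convex subgradients -/

section Subgradients

variable {E : Type*} [NormedAddCommGroup E] [InnerProductSpace ℝ E]

/-- The subgradients in the sense of convex analysis of `r`, restricted to `S`, at `x`. -/
def IsSubgradientOn (S : Set E) (r : E → ℝ) (x v : E) : Prop :=
  ∀ z ∈ S, r x + inner ℝ v (z - x) ≤ r z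

theorem IsSubgradientOn.mem_regularSubdifferential {S : Set E} {r : E → ℝ} {x v : E}
    (hv : IsSubgradientOn S r x v) (hx : x ∈ S) :
    v ∈ regularSubdifferential (fun x => (r x : EReal) + indicatorE S x) x := by
  refine ⟨add_indicatorE_lt_top_iff.2 hx, le_liminf_of_le (by isBoundedDefault) ?_⟩
  refine Eventually.of_forall fun z => EReal.div_nonneg ?_ (by exact_mod_cast norm_nonneg _)
  simp only [add_indicatorE_of_mem r hx]
  by_cases hz : z ∈ S
  · simp only [add_indicatorE_of_mem r hz]
    norm_cast
    linarith [hv z hz]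
  · simp only [add_indicatorE_of_notMem r hz]
    rw [EReal.top_sub_coe, EReal.top_sub_coe]
    exact le_top

theorem IsSubgradientOn.mem_limitingSubdifferential {S : Set E} {r : E → ℝ} {x v : E}
    (hv : IsSubgradientOn S r x v) (hx : x ∈ S) :
    v ∈ limitingSubdifferential (fun x => (r x : EReal) + indicatorE S x) x :=
  ⟨add_indicatorE_lt_top_iff.2 hx, fun _ => x, fun _ => v, tendsto_const_nhds, tendsto_const_nhds,
    fun _ => hv.mem_regularSubdifferential hx, tendsto_const_nhds⟩

/-- If the inequality fails at `z`, the difference quotient at `z` has a negative value `b`. By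
convexity the quotients at points of the segment near `x` are at most `b`, against the nonnegative
lower limit. -/
theorem ConvexOn.isSubgradientOn_of_mem_regularSubdifferential {S : Set E} {r : E → ℝ} {x v : E}
    (hr : ConvexOn ℝ S r)
    (hv : v ∈ regularSubdifferential (fun x => (r x : EReal) + indicatorE S x) x) :
    IsSubgradientOn S r x v := by
  obtain ⟨hx, hlim⟩ := hv
  rw [add_indicatorE_lt_top_iff] at hx
  intro z hz
  rcases eq_or_ne z x with rfl | hzx
  · simp
  have hn : 0 < ‖z - x‖ := norm_pos_iff.2 (sub_ne_zero.2 hzx)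
  by_contra! hlt
  set b : ℝ := (r z - r x - inner ℝ v (z - x)) / ‖z - x‖ with hb
  have hb0 : b < 0 := div_neg_of_neg_of_pos (by linarith) hn
  have hev := eventually_lt_of_lt_liminf
    (lt_of_lt_of_le (by exact_mod_cast hb0 : (b : EReal) < 0) hlim)
  have htend : Tendsto (fun t : ℝ => x + t • (z - x)) (𝓝[>] 0) (𝓝[≠] x) := by
    refine tendsto_nhdsWithin_iff.2 ⟨?_, ?_⟩
    · have : Continuous fun t : ℝ => x + t • (z - x) := by fun_prop
      simpa using this.continuousAt.tendsto.mono_left (nhdsWithin_le_nhds (a := (0 : ℝ)))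
    · filter_upwards [self_mem_nhdsWithin] with t ht
      simpa [sub_ne_zero.2 hzx] using (ne_of_gt ht : t ≠ 0)
  obtain ⟨t, ht, ht0, ht1⟩ := ((htend.eventually hev).and
    (Ioc_mem_nhdsGT (zero_lt_one' ℝ))).exists
  have hmem : x + t • (z - x) ∈ S := hr.1.add_smul_sub_mem hx hz ⟨ht0.le, ht1⟩
  simp only [add_indicatorE_of_mem r hx, add_indicatorE_of_mem r hmem] at ht
  norm_cast at ht
  have hconv : r (x + t • (z - x)) ≤ (1 - t) * r x + t * r z := by
    have := hr.2 hx hz (sub_nonneg.2 ht1) ht0.le (by ring)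
    have heq : x + t • (z - x) = (1 - t) • x + t • z := by module
    simpa [heq] using this
  rw [add_sub_cancel_left, norm_smul, Real.norm_of_nonneg ht0.le, inner_smul_right, hb,
    ← EReal.coe_div, EReal.coe_lt_coe_iff, div_lt_div_iff₀ hn (by positivity)] at ht
  have : (r z - r x - inner ℝ v (z - x)) * t <
      r (x + t • (z - x)) - r x - t * inner ℝ v (z - x) := by
    nlinarith
  nlinarith

theorem ConvexOn.isSubgradientOn_of_mem_limitingSubdifferential {S : Set E} {r : E → ℝ} {x v : E}
    (hr : ConvexOn ℝ S r) (hrc : Continuous r)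
    (hv : v ∈ limitingSubdifferential (fun x => (r x : EReal) + indicatorE S x) x) :
    IsSubgradientOn S r x v := by
  obtain ⟨-, xs, vs, hxs, -, hreg, hvs⟩ := hv
  intro z hz
  refine le_of_tendsto (((hrc.tendsto x).comp hxs).add (hvs.inner (tendsto_const_nhds.sub hxs)))
    (Eventually.of_forall fun t => hr.isSubgradientOn_of_mem_regularSubdifferential (hreg t) z hz)

end Subgradients

/-! ### Sandwich theorem, multipliers and existence of subgradients -/

section Separation

variable {E : Type*} [NormedAddCommGroup E] [InnerProductSpace ℝ E]

/-- Sandwich theorem: if the continuous concave function `-p` lies below the convex function `q` on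
`S` and the two agree at `z`, some affine function lies between them. -/
theorem ConvexOn.exists_dual_between {S : Set E} {p q : E → ℝ} {z : E} (hp : ConvexOn ℝ univ p)
    (hpc : Continuous p) (hq : ConvexOn ℝ S q) (hz : z ∈ S) (hpz : p z + q z = 0)
    (hpq : ∀ w ∈ S, 0 ≤ p w + q w) :
    ∃ φ : StrongDual ℝ E, (∀ w ∈ S, q z + φ (w - z) ≤ q w) ∧ ∀ w, p z - φ (w - z) ≤ p w := by
  have hconv : Convex ℝ {y : E × ℝ | y.2 < -p y.1} := by
    simpa using hp.neg.convex_strict_hypograph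
  have hopen : IsOpen {y : E × ℝ | y.2 < -p y.1} := isOpen_lt (by fun_prop) (by fun_prop)
  obtain ⟨f, u, hlt, hle⟩ := geometric_hahn_banach_open hconv hopen hq.convex_epigraph <| by
    rw [Set.disjoint_left]
    rintro ⟨w, t⟩ h1 ⟨h2, h3⟩
    simp only [mem_ofPred_eq] at h1 h2 h3
    linarith [hpq w h2]
  set φ : StrongDual ℝ E := f.comp (ContinuousLinearMap.inl ℝ E ℝ)
  set β : ℝ := f (0, 1)
  have hf : ∀ w t, f (w, t) = φ w + t * β := fun w t => by
    have : ((w, t) : E × ℝ) = (w, 0) + t • (0, 1) := by simp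
    rw [this, map_add, map_smul]
    simp [φ, β]
  have hlow : ∀ w, φ w - p w * β ≤ u := fun w => by
    have htend : Tendsto (fun t : ℝ => φ w + t * β) (𝓝[<] (-p w)) (𝓝 (φ w + (-p w) * β)) := by
      have : Continuous fun t : ℝ => φ w + t * β := by fun_prop
      exact this.continuousAt.tendsto.mono_left nhdsWithin_le_nhds
    have := le_of_tendsto htend (b := u) (by
      filter_upwards [self_mem_nhdsWithin] with t ht
      rw [← hf]
      exact (hlt (w, t) ht).le)
    linarith
  have hupp : ∀ w ∈ S, u ≤ φ w + q w * β := fun w hw => by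
    rw [← hf]
    exact hle (w, q w) ⟨hw, le_rfl⟩
  -- The hyperplane is not vertical: a point strictly below the contact point `(z, q z)` lies in the
  -- open hypograph.
  have hβ : 0 < β := by
    have h1 := hlt (z, -p z - 1) (by simp)
    have h2 := hupp z hz
    rw [hf] at h1
    nlinarith
  have hqz : q z = -p z := by linarith
  have hu : u = φ z + q z * β := le_antisymm (hupp z hz) (by rw [hqz]; linarith [hlow z])
  refine ⟨-(β⁻¹ • φ), fun w hw => ?_, fun w => ?_⟩
  · have := hupp w hw
    rw [hu] at this
    have h3 : (q z - q w) ≤ β⁻¹ * (φ w - φ z) := by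
      rw [inv_mul_eq_div, le_div_iff₀ hβ]; linarith
    simp only [neg_apply, smul_apply, map_sub, smul_eq_mul]
    linarith
  · have := hlow w
    rw [hu] at this
    have h3 : β⁻¹ * (φ w - φ z) ≤ p w - p z := by
      rw [inv_mul_eq_div, div_le_iff₀ hβ]
      rw [hqz] at this
      linarith
    simp only [neg_apply, smul_apply, map_sub, smul_eq_mul]
    linarith

/-- The convex Lagrange multiplier rule under Slater's condition. -/
theorem ConvexOn.exists_lagrange_multiplier {D : Set E} {g k : E → ℝ} {μ : ℝ}
    (hg : ConvexOn ℝ D g) (hk : ConvexOn ℝ D k) (hslater : ∃ x ∈ D, g x < 0)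
    (hμ : ∀ x ∈ D, g x ≤ 0 → μ ≤ k x) :
    ∃ lam : ℝ, 0 ≤ lam ∧ ∀ x ∈ D, μ ≤ k x + lam * g x := by
  set s : Set (ℝ × ℝ) := {y | ∃ x ∈ D, g x < y.1 ∧ k x < y.2} with hs
  have hconv : Convex ℝ s := by
    rintro ⟨a₁, a₂⟩ ⟨x, hx, hx1, hx2⟩ ⟨b₁, b₂⟩ ⟨y, hy, hy1, hy2⟩ a b ha hb hab
    simp only at hx1 hx2 hy1 hy2
    have key : ∀ {c d e i : ℝ}, c < d → e < i → a * c + b * e < a * d + b * i := by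
      intro c d e i h1 h2
      rcases ha.eq_or_lt with rfl | ha'
      · rw [zero_add] at hab; subst hab; linarith
      · nlinarith
    refine ⟨a • x + b • y, hg.1 hx hy ha hb hab, ?_, ?_⟩
    · exact (hg.2 hx hy ha hb hab).trans_lt (by simpa using key hx1 hy1)
    · exact (hk.2 hx hy ha hb hab).trans_lt (by simpa using key hx2 hy2)
  have hopen : IsOpen s := by
    have : s = ⋃ x ∈ D, Ioi (g x) ×ˢ Ioi (k x) := by ext; simp [hs, and_left_comm]
    rw [this]
    exact isOpen_biUnion fun x _ => isOpen_Ioi.prod isOpen_Ioi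
  -- The optimal value `μ` keeps `(0, μ)` out of the open convex set of pairs strictly dominating
  -- some `(g x, k x)`; the multiplier is the slope of a separating line.
  obtain ⟨f, hf⟩ := geometric_hahn_banach_open_point hconv hopen (x := (0, μ)) <| by
    rintro ⟨x, hx, h1, h2⟩
    exact absurd (hμ x hx h1.le) (not_le.2 h2)
  set p := f (1, 0)
  set q := f (0, 1)
  have hfpq : ∀ a b, f (a, b) = a * p + b * q := fun a b => by
    have : ((a, b) : ℝ × ℝ) = a • (1, 0) + b • (0, 1) := by simp
    rw [this, map_add, map_smul, map_smul]
    rfl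
  have hpos : ∀ x ∈ D, ∀ a > 0, ∀ b > 0, (g x + a) * p + (k x + b) * q < μ * q := by
    intro x hx a ha b hb
    have := hf (g x + a, k x + b) ⟨x, hx, by simpa, by simpa⟩
    rw [hfpq, hfpq] at this
    linarith
  obtain ⟨x₀, hx₀, hgx₀⟩ := hslater
  have hnonpos : ∀ c d : ℝ, (∀ t > 0, c + t * d < 0) → d ≤ 0 := by
    intro c d h
    by_contra! hd
    have := h (|c| / d + 1) (by positivity)
    rw [add_mul, div_mul_cancel₀ _ hd.ne'] at this
    linarith [neg_abs_le c]
  have hp : p ≤ 0 := hnonpos (g x₀ * p + (k x₀ + 1) * q - μ * q) p fun t ht => by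
    linarith [hpos x₀ hx₀ t ht 1 one_pos]
  have hq : q ≤ 0 := hnonpos ((g x₀ + 1) * p + k x₀ * q - μ * q) q fun t ht => by
    linarith [hpos x₀ hx₀ 1 one_pos t ht]
  -- Slater's condition excludes a vertical line: with `q = 0`, the choice `a = -g x₀` gives `0 <
  -- 0`.
  have hq' : q < 0 := by
    refine lt_of_le_of_ne hq fun h0 => ?_
    have := hpos x₀ hx₀ (-g x₀) (by linarith) 1 one_pos
    simp [h0] at this
  refine ⟨p / q, div_nonneg_of_nonpos hp hq, fun x hx => ?_⟩
  have hlim : g x * p + k x * q ≤ μ * q := by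
    have htend : Tendsto (fun t : ℝ => (g x + t) * p + (k x + t) * q) (𝓝[>] 0)
        (𝓝 ((g x + 0) * p + (k x + 0) * q)) := by
      have : Continuous fun t : ℝ => (g x + t) * p + (k x + t) * q := by fun_prop
      exact this.continuousAt.tendsto.mono_left nhdsWithin_le_nhds
    simpa using le_of_tendsto htend (by
      filter_upwards [self_mem_nhdsWithin] with t ht using (hpos x hx t ht t ht).le)
  by_contra! hlt
  have := mul_lt_mul_of_neg_right hlt hq'
  have h4 : (k x + p / q * g x) * q = g x * p + k x * q := by
    rw [add_mul, mul_right_comm, div_mul_cancel₀ _ hq'.ne]; ring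
  linarith

variable [CompleteSpace E]

theorem ConvexOn.exists_isSubgradientOn_univ {r : E → ℝ} (hr : ConvexOn ℝ univ r)
    (hrc : Continuous r) (x : E) : ∃ v, IsSubgradientOn univ r x v := by
  -- The sandwich degenerates to the single point `x`; only the affine minorant of `r` matters.
  obtain ⟨φ, -, h⟩ := hr.exists_dual_between hrc (convexOn_const (-r x) (convex_singleton x))
    (mem_singleton x) (by ring) (by simp)
  refine ⟨-(InnerProductSpace.toDual ℝ E).symm φ, fun z _ => ?_⟩
  rw [inner_neg_left, InnerProductSpace.toDual_symm_apply]
  linarith [h z]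

/-- If `r` decreases from `z` at most at the rate `L`, it has a subgradient of norm at most `L`. -/
theorem ConvexOn.exists_isSubgradientOn_norm_le {S : Set E} {r : E → ℝ} {z : E} {L : ℝ}
    (hr : ConvexOn ℝ S r) (hz : z ∈ S) (hL : 0 ≤ L) (h : ∀ w ∈ S, r z ≤ r w + L * ‖w - z‖) :
    ∃ v, IsSubgradientOn S r z v ∧ ‖v‖ ≤ L := by
  have hp : ConvexOn ℝ univ fun w => L * ‖w - z‖ + -r z := by
    have := ((convexOn_univ_norm (E := E)).translate_left (-z)).smul hL
    refine ConvexOn.add_const ?_ _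
    simpa [Function.comp_def, ← sub_eq_add_neg] using this
  -- The downward cone of slope `L` at `z` lies below `r`. An affine function squeezed between them
  -- has slope at most `L`, as testing at `z + y` and `z - y` shows.
  obtain ⟨φ, h1, h2⟩ := hp.exists_dual_between (by fun_prop) hr hz (by simp)
    (fun w hw => by linarith [h w hw])
  refine ⟨(InnerProductSpace.toDual ℝ E).symm φ, fun w hw => ?_, ?_⟩
  · rw [InnerProductSpace.toDual_symm_apply]
    exact h1 w hw
  · rw [LinearIsometryEquiv.norm_map]
    refine φ.opNorm_le_bound hL fun y => ?_
    rw [Real.norm_eq_abs, abs_le]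
    have h3 := h2 (z + y)
    have h4 := h2 (z - y)
    simp at h3 h4
    constructor <;> linarith

end Separation

/-! ### KL property and error bounds -/

/-- The concave power lies below its tangent at `s`; this is Bernoulli's inequality for `t / s`. -/
theorem Real.rpow_le_rpow_add_mul_sub {s t β : ℝ} (hs : 0 < s) (ht : 0 ≤ t) (hβ₀ : 0 ≤ β)
    (hβ₁ : β ≤ 1) : t ^ β ≤ s ^ β + β * s ^ (β - 1) * (t - s) := by
  have h := rpow_one_add_le_one_add_mul_self (s := t / s - 1)
    (by linarith [div_nonneg ht hs.le]) hβ₀ hβ₁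
  rw [add_sub_cancel, Real.div_rpow ht hs.le, div_le_iff₀ (Real.rpow_pos_of_pos hs β)] at h
  refine h.trans_eq ?_
  rw [Real.rpow_sub_one hs.ne']
  field_simp

section KurdykaLojasiewicz

variable {E : Type*} [NormedAddCommGroup E] [InnerProductSpace ℝ E]

theorem ofReal_le_infEDist_zero_iff {F : Type*} [SeminormedAddCommGroup F] {s : Set F} {c : ℝ} :
    ENNReal.ofReal c ≤ Metric.infEDist 0 s ↔ ∀ v ∈ s, c ≤ ‖v‖ := by
  simp [Metric.le_infEDist]

/-- The KL bound for a restricted continuous function, in terms of real numbers. -/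
theorem HasKLExponentAt.exists_le_norm {S : Set E} {r : E → ℝ} {α : ℝ} {a : E}
    (h : HasKLExponentAt (fun x => (r x : EReal) + indicatorE S x) α a) (ha : a ∈ S) :
    ∃ c > 0, ∃ ε > 0, ∃ ν > 0, ∀ x ∈ S, ‖x - a‖ ≤ ε → r a < r x → r x < r a + ν →
      ∀ v, IsSubgradientOn S r x v → c * (r x - r a) ^ α ≤ ‖v‖ := by
  obtain ⟨c, hc, ε, hε, ν, hν, hb⟩ := h.bound
  obtain ⟨ν', hν', hνν'⟩ := EReal.lt_iff_exists_real_btwn.1 hν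
  refine ⟨c, hc, ε, hε, ν', by exact_mod_cast hν', fun x hx hxa hlt hlt' v hv => ?_⟩
  have := hb x hxa
  simp only [add_indicatorE_of_mem r hx, add_indicatorE_of_mem r ha] at this
  refine ofReal_le_infEDist_zero_iff.1 (this (by exact_mod_cast hlt) ?_) v
    (hv.mem_limitingSubdifferential hx)
  have h1 : (r x : EReal) < r a + ν' := by exact_mod_cast hlt'
  exact h1.trans_le (add_le_add_right hνν'.le _)

theorem ConvexOn.hasKLExponentAt {S : Set E} {r : E → ℝ} {α c ε ν : ℝ} {a v₀ : E}
    (hr : ConvexOn ℝ S r) (hrc : Continuous r) (hS : IsClosed S) (hα₀ : 0 ≤ α) (hα₁ : α < 1)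
    (ha : a ∈ S) (hv₀ : IsSubgradientOn S r a v₀) (hc : 0 < c) (hε : 0 < ε) (hν : 0 < ν)
    (hb : ∀ x ∈ S, ‖x - a‖ ≤ ε → r a < r x → r x < r a + ν →
      ∀ v, IsSubgradientOn S r x v → c * (r x - r a) ^ α ≤ ‖v‖) :
    HasKLExponentAt (fun x => (r x : EReal) + indicatorE S x) α a where
  proper := isProper_add_indicatorE r ⟨a, ha⟩
  closed := lowerSemicontinuous_add_indicatorE hS hrc
  exponent_nonneg := hα₀
  exponent_lt_one := hα₁
  mem_dom := ⟨v₀, hv₀.mem_limitingSubdifferential ha⟩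
  bound := by
    refine ⟨c, hc, ε, hε, ν, by exact_mod_cast hν, fun x hxa hlt hlt' => ?_⟩
    simp only [add_indicatorE_of_mem r ha] at hlt hlt'
    have hx : x ∈ S := by
      by_contra hx
      simp only [add_indicatorE_of_notMem r hx] at hlt'
      exact not_top_lt hlt'
    simp only [add_indicatorE_of_mem r hx] at hlt hlt'
    simp only [add_indicatorE_of_mem r hx, add_indicatorE_of_mem r ha]
    refine ofReal_le_infEDist_zero_iff.2 fun v hv => ?_
    exact hb x hx hxa (by exact_mod_cast hlt) (by exact_mod_cast hlt') v
      (hr.isSubgradientOn_of_mem_limitingSubdifferential hrc hv)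

/-- Away from the minimizers, a convex function has the KL property with every exponent. -/
theorem ConvexOn.hasKLExponentAt_of_lt {S : Set E} {r : E → ℝ} {α : ℝ} {a y v₀ : E}
    (hr : ConvexOn ℝ S r) (hrc : Continuous r) (hS : IsClosed S) (hα₀ : 0 ≤ α) (hα₁ : α < 1)
    (ha : a ∈ S) (hv₀ : IsSubgradientOn S r a v₀) (hy : y ∈ S) (hya : r y < r a) :
    HasKLExponentAt (fun x => (r x : EReal) + indicatorE S x) α a := by
  -- The subgradient inequality at `y` gives `r a - r y ≤ ‖v‖ * ‖y - x‖`, with `‖y - x‖ ≤ 1 + ‖y -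
  -- a‖`; taking `ν = 1` keeps the power at most `1`.
  refine hr.hasKLExponentAt (c := (r a - r y) / (1 + ‖y - a‖)) (ε := 1) (ν := 1) hrc hS hα₀ hα₁ ha
    hv₀ (div_pos (by linarith) (by positivity)) one_pos one_pos fun x hx hxa hlt hlt' v hv => ?_
  have h1 : (r x - r a) ^ α ≤ 1 := Real.rpow_le_one (by linarith) (by linarith) hα₀
  refine (mul_le_of_le_one_right (div_nonneg (by linarith) (by positivity)) h1).trans ?_
  rw [div_le_iff₀ (by positivity)]
  have h2 : ‖y - x‖ ≤ 1 + ‖y - a‖ := by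
    have := norm_sub_le_norm_sub_add_norm_sub y a x
    rw [norm_sub_rev a x] at this
    linarith
  have h3 := (abs_le.1 (abs_real_inner_le_norm v (y - x))).1
  linarith [hv y hy, mul_le_mul_of_nonneg_left h2 (norm_nonneg v)]

/-- The KL property of a convex function at a minimizer implies a Hölder error bound. -/
theorem ConvexOn.exists_error_bound [ProperSpace E] {S : Set E} {r : E → ℝ} {α c ε ν : ℝ} {a : E}
    (hr : ConvexOn ℝ S r) (hrc : Continuous r) (hS : IsClosed S) (hα₀ : 0 ≤ α) (hα₁ : α < 1)
    (ha : a ∈ S) (hmin : ∀ x ∈ S, r a ≤ r x) (hc : 0 < c)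
    (hb : ∀ x ∈ S, ‖x - a‖ ≤ ε → r a < r x → r x < r a + ν →
      ∀ v, IsSubgradientOn S r x v → c * (r x - r a) ^ α ≤ ‖v‖) :
    ∃ κ > 0, ∀ x ∈ S, ‖x - a‖ ≤ ε / 2 → r x < r a + ν →
      ∃ p ∈ S, r p = r a ∧ κ * ‖x - p‖ ≤ (r x - r a) ^ (1 - α) := by
  have hα' : 0 < 1 - α := sub_pos.2 hα₁
  set κ := c * (1 - α) / 2 with hκ
  have hκ0 : 0 < κ := by positivity
  refine ⟨κ, hκ0, fun x hx hxa hxν => ?_⟩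
  -- Ekeland-style argument: a minimizer `z` of this penalized function must satisfy `r z = r a`,
  -- and comparing `Φ z` with `Φ x` is then the error bound.
  set Φ : E → ℝ := fun z => (r z - r a) ^ (1 - α) + κ * ‖z - x‖ with hΦ
  have hΦc : Continuous Φ :=
    ((hrc.sub continuous_const).rpow_const fun _ => Or.inr hα'.le).add (by fun_prop)
  have hpow : ∀ w ∈ S, 0 ≤ (r w - r a) ^ (1 - α) := fun w hw =>
    Real.rpow_nonneg (sub_nonneg.2 (hmin w hw)) _
  have hΦa : Φ a = κ * ‖a - x‖ := by simp [hΦ, Real.zero_rpow hα'.ne']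
  obtain ⟨z, ⟨hzS, hzb⟩, hz⟩ := ((isCompact_closedBall x ‖a - x‖).inter_left hS).exists_isMinOn
    ⟨a, ha, by simp [dist_eq_norm]⟩ hΦc.continuousOn
  rw [Metric.mem_closedBall, dist_eq_norm] at hzb
  -- Outside the ball the penalty alone exceeds `Φ a`, so the minimum is global on `S`.
  have hzmin : ∀ w ∈ S, Φ z ≤ Φ w := by
    intro w hw
    by_cases hwb : ‖w - x‖ ≤ ‖a - x‖
    · exact hz ⟨hw, by simpa [dist_eq_norm] using hwb⟩
    · have h1 : Φ z ≤ Φ a := hz ⟨ha, by simp [dist_eq_norm]⟩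
      have h2 := mul_le_mul_of_nonneg_left (not_le.1 hwb).le hκ0.le
      have h3 : κ * ‖w - x‖ ≤ Φ w := le_add_of_nonneg_left (hpow w hw)
      linarith
  have hzx : (r z - r a) ^ (1 - α) + κ * ‖z - x‖ ≤ (r x - r a) ^ (1 - α) := by
    simpa [hΦ] using hzmin x hx
  refine ⟨z, hzS, ?_, by rw [norm_sub_rev]; linarith [hpow z hzS]⟩
  by_contra hne
  have hlt : r a < r z := lt_of_le_of_ne (hmin z hzS) (Ne.symm hne)
  set s := r z - r a with hs
  have hs0 : 0 < s := sub_pos.2 hlt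
  have hsα : 0 < s ^ α := Real.rpow_pos_of_pos hs0 α
  have hzle : r z ≤ r x := by
    have h1 : s ^ (1 - α) ≤ (r x - r a) ^ (1 - α) := by
      linarith [mul_nonneg hκ0.le (norm_nonneg (z - x))]
    have := (Real.rpow_le_rpow_iff hs0.le (sub_nonneg.2 (hmin x hx)) hα').1 h1
    linarith
  -- Linearizing the power at `s` turns minimality of `z` into a bound on the rate of decrease of
  -- `r`. The half in `κ` yields a subgradient of norm at most `c / 2 * s ^ α`, which the KL bound
  -- forbids.
  obtain ⟨v, hv, hvL⟩ := hr.exists_isSubgradientOn_norm_le (L := c / 2 * s ^ α) hzS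
    (by positivity) fun w hw => by
      have h1 := hzmin w hw
      have h2 := Real.rpow_le_rpow_add_mul_sub hs0 (sub_nonneg.2 (hmin w hw)) hα'.le
        (by linarith : 1 - α ≤ 1)
      have h3 : ‖w - x‖ ≤ ‖w - z‖ + ‖z - x‖ := norm_sub_le_norm_sub_add_norm_sub w z x
      have h4 : κ * ‖w - x‖ ≤ κ * ‖w - z‖ + κ * ‖z - x‖ := by
        rw [← mul_add]; exact mul_le_mul_of_nonneg_left h3 hκ0.le
      have h5 : 0 ≤ (1 - α) * s ^ (1 - α - 1) * (r w - r z) + κ * ‖w - z‖ := by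
        have : r w - r z = r w - r a - s := by ring
        rw [this]
        simp only [hΦ] at h1
        linarith
      rw [show 1 - α - 1 = -α by ring, Real.rpow_neg hs0.le, hκ] at h5
      have h6 : (1 - α) * (s ^ α)⁻¹ * (r w - r z) + c * (1 - α) / 2 * ‖w - z‖ =
          ((1 - α) / s ^ α) * (r w - r z + c / 2 * s ^ α * ‖w - z‖) := by
        field_simp
      rw [h6] at h5
      linarith [nonneg_of_mul_nonneg_right h5 (by positivity)]
  -- This is why `x` is taken within `ε / 2` of `a`: `z` is no farther from `x` than `a` is.
  have hza : ‖z - a‖ ≤ ε := by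
    have := norm_sub_le_norm_sub_add_norm_sub z x a
    rw [norm_sub_rev a x] at hzb
    linarith
  have := hb z hzS hza hlt (by linarith) v hv
  nlinarith

/-- A Hölder error bound implies the KL property of a convex function. -/
theorem ConvexOn.hasKLExponentAt_of_error_bound {S : Set E} {r : E → ℝ} {α κ ε ν : ℝ} {a v₀ : E}
    (hr : ConvexOn ℝ S r) (hrc : Continuous r) (hS : IsClosed S) (hα₀ : 0 ≤ α) (hα₁ : α < 1)
    (ha : a ∈ S) (hv₀ : IsSubgradientOn S r a v₀) (hκ : 0 < κ) (hε : 0 < ε) (hν : 0 < ν)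
    (hb : ∀ x ∈ S, ‖x - a‖ ≤ ε → r a < r x → r x < r a + ν →
      ∃ p ∈ S, r p = r a ∧ κ * ‖x - p‖ ≤ (r x - r a) ^ (1 - α)) :
    HasKLExponentAt (fun x => (r x : EReal) + indicatorE S x) α a := by
  refine hr.hasKLExponentAt hrc hS hα₀ hα₁ ha hv₀ hκ hε hν fun x hx hxa hlt hlt' v hv => ?_
  obtain ⟨p, hp, hpa, hle⟩ := hb x hx hxa hlt hlt'
  have hd : 0 < r x - r a := sub_pos.2 hlt
  have h1 := hv p hp
  have h2 := (abs_le.1 (abs_real_inner_le_norm v (p - x))).1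
  rw [norm_sub_rev p x] at h2
  -- The subgradient inequality at `p` gives `r x - r a ≤ ‖v‖ * ‖x - p‖`; the error bound controls
  -- the distance.
  have h3 : κ * (r x - r a) ≤ ‖v‖ * (r x - r a) ^ (1 - α) := by
    calc κ * (r x - r a) ≤ κ * (‖v‖ * ‖x - p‖) :=
          mul_le_mul_of_nonneg_left (by linarith) hκ.le
      _ = ‖v‖ * (κ * ‖x - p‖) := by ring
      _ ≤ _ := mul_le_mul_of_nonneg_left hle (norm_nonneg v)
  have h4 : r x - r a = (r x - r a) ^ α * (r x - r a) ^ (1 - α) := by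
    rw [← Real.rpow_add hd, add_sub_cancel, Real.rpow_one]
  refine le_of_mul_le_mul_right ?_ (Real.rpow_pos_of_pos hd (1 - α))
  rwa [mul_assoc, ← h4]

end KurdykaLojasiewicz

/-! ### The Lagrangian relaxation theorem -/

theorem mainTheorem8 (m n : ℕ)
    (l : EuclideanSpace ℝ (Fin m) → ℝ) (hl_cont : Continuous l)
    (hl_conv : StrictConvexOn ℝ Set.univ l)
    (A : Matrix (Fin m) (Fin n) ℝ)
    (h : EuclideanSpace ℝ (Fin n) → ℝ) (hh : ∀ x, h x = l (WithLp.toLp 2 (A.mulVec x.ofLp)))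
    (g : EuclideanSpace ℝ (Fin n) → ℝ) (hg_cont : Continuous g)
    (hg_conv : ConvexOn ℝ Set.univ g)
    (α : ℝ) (hα₀ : 0 < α) (hα₁ : α < 1)
    (D : Set (EuclideanSpace ℝ (Fin n))) (hD_closed : IsClosed D) (hD_conv : Convex ℝ D)
    (C : Set (EuclideanSpace ℝ (Fin n))) (hC : C = {x | g x ≤ 0})
    (h_slater : ∃ x₀ ∈ D, g x₀ < 0)
    (h_active : (⨅ x ∈ D, (h x : EReal)) < ⨅ x ∈ C ∩ D, (h x : EReal))
    (h_lagrange : ∀ lam : ℝ, 0 < lam →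
      IsKLFunctionWithExponent (fun x => ((h x + lam * g x : ℝ) : EReal) + indicatorE D x) α) :
    ∀ a ∈ C ∩ D,
      HasKLExponentAt (fun x => (h x : EReal) + indicatorE C x + indicatorE D x) α a := by
  intro a ha
  set T : EuclideanSpace ℝ (Fin n) →L[ℝ] EuclideanSpace ℝ (Fin m) :=
    LinearMap.toContinuousLinearMap (Matrix.toLpLin 2 2 A) with hT
  have hhT : h = l ∘ T := funext fun x => hh x
  have hh_cont : Continuous h := hhT ▸ hl_cont.comp T.continuous
  have hh_conv : ConvexOn ℝ univ h := hhT ▸ hl_conv.convexOn.comp_linearMap T.toLinearMap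
  have hCg : ∀ x, x ∈ C ↔ g x ≤ 0 := fun x => by rw [hC]; rfl
  have hCD_closed : IsClosed (C ∩ D) := by
    rw [hC]; exact (isClosed_le hg_cont continuous_const).inter hD_closed
  have hCD_conv : Convex ℝ (C ∩ D) := by
    rw [hC]; simpa using (hg_conv.convex_le 0).inter hD_conv
  have hh_CD : ConvexOn ℝ (C ∩ D) h := hh_conv.subset (subset_univ _) hCD_conv
  simp only [add_assoc, indicatorE_add_indicatorE]
  obtain ⟨v₀, hv₀⟩ := hh_conv.exists_isSubgradientOn_univ hh_cont a
  replace hv₀ : IsSubgradientOn (C ∩ D) h a v₀ := fun z _ => hv₀ z (mem_univ z)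
  by_cases hmin : ∃ y ∈ C ∩ D, h y < h a
  · obtain ⟨y, hy, hya⟩ := hmin
    exact hh_CD.hasKLExponentAt_of_lt hh_cont hCD_closed hα₀.le hα₁ ha hv₀ hy hya
  push Not at hmin
  obtain ⟨lam, hlam, hlag⟩ := (hg_conv.subset (subset_univ _) hD_conv).exists_lagrange_multiplier
    (hh_conv.subset (subset_univ _) hD_conv) h_slater
    (fun x hx hgx => hmin x ⟨(hCg x).2 hgx, hx⟩)
  -- With a zero multiplier, `a` would minimize `h` over all of `D`, closing the gap between the
  -- infima.
  have hlam0 : 0 < lam := by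
    refine lt_of_le_of_ne hlam fun h0 => ?_
    refine h_active.not_ge ((iInf₂_le a ha).trans (le_iInf₂ fun x hx => ?_))
    have := hlag x hx
    rw [← h0, zero_mul, add_zero] at this
    exact_mod_cast this
  -- Complementary slackness.
  have hga : g a = 0 := by
    refine le_antisymm ((hCg a).1 ha.1) ?_
    have := hlag a ha.2
    exact nonneg_of_mul_nonneg_right (by linarith) hlam0
  set r : EuclideanSpace ℝ (Fin n) → ℝ := fun x => h x + lam * g x with hr
  have hra : r a = h a := by simp [hr, hga]
  have hr_conv : ConvexOn ℝ univ r := hh_conv.add (hg_conv.smul hlam)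
  have hr_D : ConvexOn ℝ D r := hr_conv.subset (subset_univ _) hD_conv
  have hr_cont : Continuous r := hh_cont.add (continuous_const.mul hg_cont)
  have hr_min : ∀ x ∈ D, r a ≤ r x := fun x hx => hra ▸ hlag x hx
  have hargmin : ∀ p ∈ D, r p = r a → p ∈ C ∩ D ∧ h p = h a := by
    intro p hp hpa
    -- If `T p ≠ T a`, strict convexity of `l` puts `r` at the midpoint strictly below its minimum.
    have hTp : T p = T a := by
      by_contra hne
      have h1 := hl_conv.2 (mem_univ (T p)) (mem_univ (T a)) hne
        (by norm_num : (0 : ℝ) < 1 / 2) (by norm_num : (0 : ℝ) < 1 / 2) (by norm_num)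
      have h2 := hg_conv.2 (mem_univ p) (mem_univ a)
        (by norm_num : (0 : ℝ) ≤ 1 / 2) (by norm_num : (0 : ℝ) ≤ 1 / 2) (by norm_num)
      have h3 := hr_min _ (hD_conv hp ha.2
        (by norm_num : (0 : ℝ) ≤ 1 / 2) (by norm_num : (0 : ℝ) ≤ 1 / 2) (by norm_num))
      rw [← map_smul, ← map_smul, ← map_add] at h1
      simp only [hr, hhT, Function.comp_apply, smul_eq_mul] at h1 h2 h3 hpa
      nlinarith [mul_le_mul_of_nonneg_left h2 hlam]
    have hhp : h p = h a := by simp [hhT, hTp]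
    have hgp : lam * g p = 0 := by simp only [hr] at hpa; rw [hga] at hpa; linarith
    have hgp' : g p = 0 := (mul_eq_zero.1 hgp).resolve_left hlam0.ne'
    exact ⟨⟨(hCg p).2 hgp'.le, hp⟩, hhp⟩
  have hzero : IsSubgradientOn D r a 0 := fun z hz => by simpa using hr_min z hz
  obtain ⟨c, hc, ε, hε, ν, hν, hb⟩ := ((h_lagrange lam hlam0).kl a
    ⟨0, hzero.mem_limitingSubdifferential ha.2⟩).exists_le_norm ha.2
  obtain ⟨κ, hκ, herr⟩ := hr_D.exists_error_bound hr_cont hD_closed hα₀.le hα₁ ha.2 hr_min hc hb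
  refine hh_CD.hasKLExponentAt_of_error_bound hh_cont hCD_closed hα₀.le hα₁ ha hv₀ hκ
    (half_pos hε) hν fun x hx hxa _ hlt => ?_
  -- This transfers both the level restriction and the error bound from `r` to `h`.
  have hrx : r x ≤ h x := by
    simpa [hr] using mul_nonpos_of_nonneg_of_nonpos hlam ((hCg x).1 hx.1)
  obtain ⟨p, hp, hpa, hle⟩ := herr x hx.2 hxa (by rw [hra]; linarith)
  obtain ⟨hpCD, hph⟩ := hargmin p hp hpa
  refine ⟨p, hpCD, hph, hle.trans ?_⟩
  refine Real.rpow_le_rpow (sub_nonneg.2 (hr_min x hx.2)) (by rw [hra]; linarith) (by linarith)
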